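/- Let $n,k$ be integers with $1<k<n$ and put $m := n-k$. For a $k$-element set $S\subseteq\{1,\dots,n\}$ let $|\psi_S\rangle := \frac{1}{\sqrt k}\sum_{i\in S}|i\rangle \in \mathbb{C}^n$ be the quantum sample of $S$. An algorithm for the Quantum Coupon Collector problem with parameters $n,k$ and error probability at most $\delta$ that uses $t$ samples is a quantum measurement (POVM) on $(\mathbb{C}^n)^{\otimes t}$ whose outcomes are subsets of $\{1,\dots,n\}$ and which, for every $k$-element set $S$, when applied to the state $|\psi_S\rangle^{\otimes t}$, produces an outcome different from $S$ with probability at most $\delta$. Let $\delta\in(0,1/40]$ be a constant, and let $c_0 := \frac12\ln\!\left(\frac{1-\delta}{32\,\delta}\right)$. Any algorithm for the Quantum Coupon Collector problem with parameters $n,k$ and error probability at most $\delta$ uses at least $$(1-o_k(1))\;k\,\ln\left(\min\{k,\,m+1\}\right)$$ samples whenever $\frac{\ln k}{k}\le\min\left\{\frac{c_0}{20},\ \delta\ln 2\right\}$. Here $o_k(1)$ tends to $0$ as $k\to\infty$, uniformly in $n$: for each $\delta\in(0,1/40]$ there is a function $\varepsilon:\mathbb{N}\to\mathbb{R}$ with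 $\varepsilon(k)\to0$ as $k\to\infty$ such that, for all $n,k$ as above, every such algorithm uses $t\ge(1-\varepsilon(k))\,k\ln(\min\{k,m+1\})$ samples. -/

import Mathlib

open Filter Topology
open scoped ComplexOrder

/-- The quantum sample `|ψ_S⟩ = |S|^{-1/2} ∑_{i ∈ S} |i⟩` in `ℂ^n` of a subset `S` of an
`n`-element set: the vector of its amplitudes in the standard basis. -/
noncomputable def quantumSample {n : ℕ} (S : Finset (Fin n)) : Fin n → ℂ :=
  fun i => if i ∈ S then ((1 / Real.sqrt (S.card : ℝ) : ℝ) : ℂ) else 0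

/-- The vector `|ψ_S⟩^{⊗ t}` in `(ℂ^n)^{⊗ t}`, a space whose standard basis is indexed by
`Fin t → Fin n`. -/
noncomputable def quantumSamples {n : ℕ} (t : ℕ) (S : Finset (Fin n)) : (Fin t → Fin n) → ℂ :=
  fun x => ∏ j, quantumSample S (x j)

/-- The density matrix `(|ψ_S⟩⟨ψ_S|)^{⊗ t}` of `t` quantum samples of `S`. -/
noncomputable def quantumSamplesState {n : ℕ} (t : ℕ) (S : Finset (Fin n)) :
    Matrix (Fin t → Fin n) (Fin t → Fin n) ℂ :=
  Matrix.vecMulVec (quantumSamples t S) (star (quantumSamples t S))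

/-- A quantum measurement (POVM) on `ℂ^ι` with outcomes in the finite set `α`. -/
structure QuantumMeasurement (ι α : Type) [Fintype ι] [DecidableEq ι] [Fintype α] where
  /-- the measurement operator of each outcome -/
  op : α → Matrix ι ι ℂ
  posSemidef : ∀ a, (op a).PosSemidef
  sum_eq_one : ∑ a, op a = 1

/-- The probability of outcome `a` when a system in state `ρ` is measured: `Tr (M_a ρ)`. -/
noncomputable def QuantumMeasurement.prob {ι α : Type} [Fintype ι] [DecidableEq ι] [Fintype α]
    (M : QuantumMeasurement ι α) (ρ : Matrix ι ι ℂ) (a : α) : ℝ :=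
  (Matrix.trace (M.op a * ρ)).re

/-- A learning algorithm that uses `t` quantum samples of an unknown subset of an `n`-element
set and outputs a subset. Whatever the algorithm does to the samples (with ancillas, intermediate
measurements and randomness), the distribution of its output is given by a measurement
of the `t` samples; every such measurement is allowed, with no bound on its complexity. -/
abbrev CouponLearner (n t : ℕ) : Type :=
  QuantumMeasurement (Fin t → Fin n) (Finset (Fin n))

/-- The probability that the output of the algorithm differs from the unknown set `S`. -/
noncomputable def CouponLearner.errorProb {n t : ℕ} (A : CouponLearner n t)
    (S : Finset (Fin n)) : ℝ :=
  ∑ S' ∈ Finset.univ.filter (fun S' => S' ≠ S), A.prob (quantumSamplesState t S) S'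

/-- The algorithm solves the Quantum Coupon Collector problem with parameters `n, k` and with
probability of error at most `δ`: this bound holds for every `k`-element set. -/
def CouponLearner.Solves {n t : ℕ} (A : CouponLearner n t) (k : ℕ) (δ : ℝ) : Prop :=
  ∀ S : Finset (Fin n), S.card = k → A.errorProb S ≤ δ

/-- `c₀ = (1/2) ln ((1 - δ) / (32 δ))`. -/
noncomputable def couponConst (δ : ℝ) : ℝ := (1 / 2) * Real.log ((1 - δ) / (32 * δ))

/-! Let the unknown set vary only inside a universe of `k + s + 1` coupons, as the complement of a
missing set `z` of size `s + 1`. The Gram matrix of the states has entries `((k - s - 1 + |z ∩ z'|)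
/ k) ^ t`, so it belongs to the Johnson scheme. On the kernel of `upSum` its quadratic form is a
single scalar times the squared norm (`sum_kernel_inter_eq`). That scalar is the chance that `t`
classical draws from `k` coupons hit `s + 1` given ones, at most `(1 - (1 - 1/k)^t)^(s+1)`. When `s`
is small against `k`, every point mass is close to this kernel (`exists_decomposition_single`), so
the success probability of any measurement is bounded by 5/4 of the scalar plus a small error
(`sum_norm_sq_le_of_decomposition`). For `t ≤ (k - 1) log (s + 2)` the scalar is at most 1/2, too
little for error 1/40. The bound follows with `s + 1 = min (n - k) ⌊k/20⌋`. -/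

/-! ### Finite differences of powers as hitting probabilities -/

-- Leibniz rule: only two terms survive because the second difference of `x` vanishes.
open fwdDiff in
theorem fwdDiff_iter_natCast_mul (f : ℕ → ℝ) (r y : ℕ) :
    (Δ_[1])^[r + 1] (fun x : ℕ => (x : ℝ) * f x) y =
      (y : ℝ) * (Δ_[1])^[r + 1] f y + ((r : ℝ) + 1) * (Δ_[1])^[r] f (y + 1) := by
  induction r generalizing y with
  | zero => simp [fwdDiff]; ring
  | succ r ih =>
    rw [Function.iterate_succ_apply', Function.iterate_succ_apply' (n := r + 1) (x := f)]
    simp only [fwdDiff] at ih ⊢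
    rw [ih, ih]
    have h := Function.iterate_succ_apply' (fwdDiff (1 : ℕ)) r f
    have h1 := congrFun h (y + 1)
    simp only [fwdDiff] at h1
    rw [h1]
    push_cast
    ring

open fwdDiff in
/-- The `r`-th difference of `x ↦ (x / k) ^ t` at `k - r` is the probability that `t` uniform
samples from `k` elements hit `r` given ones; it is at most its value for independent hits. -/
theorem fwdDiff_iter_div_pow_mem_Icc {k : ℕ} (hk : 0 < k) (t : ℕ) :
    ∀ r y : ℕ, y + r = k →
      (Δ_[1])^[r] (fun x : ℕ => ((x : ℝ) / k) ^ t) y ∈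
        Set.Icc 0 ((1 - (1 - 1 / (k : ℝ)) ^ t) ^ r) := by
  have hk0 : (0 : ℝ) < k := by exact_mod_cast hk
  have hk1 : 1 / (k : ℝ) ≤ 1 := by
    rw [div_le_one hk0]; exact_mod_cast hk
  induction t with
  | zero =>
    intro r y _
    rcases r with _ | r
    · simp
    · have h0 : ∀ r : ℕ, (Δ_[1])^[r] (fun _ : ℕ => (0 : ℝ)) = fun _ => 0 := by
        intro r
        induction r with
        | zero => rfl
        | succ r ih => rw [Function.iterate_succ_apply, fwdDiff_const, ih]
      simp [Function.iterate_succ_apply, h0]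
  | succ t ih =>
    intro r y hy
    rcases r with _ | r
    · obtain rfl : y = k := by omega
      simp [hk0.ne']
    -- Condition on one more draw: it misses the `r + 1` targets in `y` of `k` cases and otherwise
    -- leaves `r` of them to hit.
    · have hf : (fun x : ℕ => ((x : ℝ) / k) ^ (t + 1)) =
          (1 / (k : ℝ)) • fun x : ℕ => (x : ℝ) * ((x : ℝ) / k) ^ t := by
        ext x; simp; ring
      rw [hf, fwdDiff_iter_const_smul, Pi.smul_apply, fwdDiff_iter_natCast_mul, smul_eq_mul]
      obtain ⟨h1, h2⟩ := ih (r + 1) y hy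
      obtain ⟨h3, h4⟩ := ih r (y + 1) (by omega)
      refine ⟨by positivity, ?_⟩
      have hq0 : 0 ≤ (1 - 1 / (k : ℝ)) ^ t := pow_nonneg (by linarith) t
      have hq1 : (1 - 1 / (k : ℝ)) ^ t ≤ 1 :=
        pow_le_one₀ (by linarith) (by linarith [one_div_pos.2 hk0])
      set q := (1 - 1 / (k : ℝ)) ^ t
      have hy' : (y : ℝ) = k - (r + 1) := by rw [← hy]; push_cast; ring
      calc _ ≤ 1 / (k : ℝ) * (y * (1 - q) ^ (r + 1) + (r + 1) * (1 - q) ^ r) := by gcongr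
        _ = (1 - q) ^ (r + 1) + ((r + 1 : ℕ) : ℝ) * (1 - q) ^ r * (q / k) := by
          rw [hy']; push_cast; field_simp; ring
        -- The left side is the first two terms of the binomial expansion, and `1 - q + q/k = 1 - q
        -- (1 - 1/k)`.
        _ ≤ (1 - q + q / k) ^ (r + 1) := by
          have hb : 0 ≤ 1 - q := by linarith
          have hc : 0 ≤ q / k := by positivity
          have key : ∀ n : ℕ, (1 - q) ^ (n + 1) + ((n + 1 : ℕ) : ℝ) * (1 - q) ^ n * (q / k)
              ≤ (1 - q + q / k) ^ (n + 1) := by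
            intro n
            induction n with
            | zero => simp
            | succ n ih =>
              rw [pow_succ (1 - q + q / k)]
              refine le_trans ?_ (mul_le_mul_of_nonneg_right ih (by positivity))
              have : 0 ≤ ((n + 1 : ℕ) : ℝ) * (1 - q) ^ n * (q / k) * (q / k) := by positivity
              push_cast at this ⊢
              ring_nf at this ⊢
              linarith
          exact key r
        _ = _ := by
          congr 1
          rw [pow_succ]; ring

/-! ### Up and down operators on the Boolean lattice -/

/-- The sum of `f` over the sets obtained from `B` by adding an element. -/
def upSum {α : Type*} [Fintype α] [DecidableEq α] (f : Finset α → ℝ) (B : Finset α) : ℝ :=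
  ∑ i ∈ Bᶜ, f (insert i B)

/-- The sum of `f` over the sets obtained from `A` by removing an element. -/
def downSum {α : Type*} [Fintype α] [DecidableEq α] (f : Finset α → ℝ) (A : Finset α) : ℝ :=
  ∑ i ∈ A, f (A.erase i)

section Boolean

variable {α : Type*} [Fintype α] [DecidableEq α]

theorem sum_mul_downSum (f g : Finset α → ℝ) :
    ∑ A, f A * downSum g A = ∑ B, upSum f B * g B := by
  simp only [downSum, upSum, Finset.mul_sum, Finset.sum_mul]
  rw [Finset.sum_sigma', Finset.sum_sigma']
  refine Finset.sum_bij' (fun p _ => ⟨p.1.erase p.2, p.2⟩) (fun p _ => ⟨insert p.2 p.1, p.2⟩)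
    ?_ ?_ ?_ ?_ ?_
  · simp
  · simp
  · rintro ⟨A, i⟩ h
    simp only [Finset.mem_sigma, Finset.mem_univ, true_and] at h
    simp [Finset.insert_erase h]
  · rintro ⟨B, i⟩ h
    simp only [Finset.mem_sigma, Finset.mem_univ, true_and, Finset.mem_compl] at h
    simp [Finset.erase_insert h]
  · rintro ⟨A, i⟩ h
    simp only [Finset.mem_sigma, Finset.mem_univ, true_and] at h
    simp [Finset.insert_erase h]

/-- The terms that exchange an element of `B` for one outside agree on both sides; the diagonal
terms differ by `|Bᶜ| - |B|`. -/
theorem upSum_downSum (f : Finset α → ℝ) (B : Finset α) :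
    upSum (downSum f) B =
      downSum (upSum f) B + ((Fintype.card α : ℝ) - 2 * (B.card : ℝ)) * f B := by
  have h1 : upSum (downSum f) B =
      ∑ i ∈ Bᶜ, (f B + ∑ j ∈ B, f (insert i (B.erase j))) := by
    refine Finset.sum_congr rfl fun i hi => ?_
    rw [Finset.mem_compl] at hi
    rw [downSum, Finset.sum_insert hi, Finset.erase_insert hi]
    congr 1
    refine Finset.sum_congr rfl fun j hj => ?_
    rw [Finset.erase_insert_of_ne]
    rintro rfl
    exact hi hj
  have h2 : downSum (upSum f) B =
      ∑ j ∈ B, (f B + ∑ i ∈ Bᶜ, f (insert i (B.erase j))) := by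
    refine Finset.sum_congr rfl fun j hj => ?_
    have hc : (B.erase j)ᶜ = insert j Bᶜ := by
      ext x; simp [or_iff_not_imp_left]
    rw [upSum, hc, Finset.sum_insert (by simpa using hj), Finset.insert_erase hj]
  rw [h1, h2, Finset.sum_add_distrib, Finset.sum_add_distrib, Finset.sum_comm]
  simp only [Finset.sum_const, nsmul_eq_mul]
  rw [Finset.card_compl, Nat.cast_sub (Finset.card_le_univ B)]
  ring

/-- The commutation relation as a quadratic form. For `2 * s < |α|` it bounds the norm of `downSum
f` from below. -/
theorem sum_sq_downSum {s : ℕ} {f : Finset α → ℝ} (hf : ∀ B, B.card ≠ s → f B = 0) :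
    ∑ A, downSum f A ^ 2 =
      ∑ B, upSum f B ^ 2 + ((Fintype.card α : ℝ) - 2 * s) * ∑ B, f B ^ 2 := by
  have h1 : ∀ B, upSum (downSum f) B * f B =
      f B * downSum (upSum f) B + ((Fintype.card α : ℝ) - 2 * s) * f B ^ 2 := by
    intro B
    rw [upSum_downSum]
    by_cases h : B.card = s
    · rw [h]; ring
    · simp [hf B h]
  simp only [sq (downSum f _)]
  rw [sum_mul_downSum, Finset.sum_congr rfl fun B _ => h1 B, Finset.sum_add_distrib,
    sum_mul_downSum, Finset.mul_sum]
  simp only [sq]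

theorem upSum_eq_zero_of_card_ne {s : ℕ} {f : Finset α → ℝ}
    (hf : ∀ B, B.card ≠ s + 1 → f B = 0) {B : Finset α} (hB : B.card ≠ s) : upSum f B = 0 := by
  refine Finset.sum_eq_zero fun i hi => hf _ ?_
  rw [Finset.card_insert_of_notMem (Finset.mem_compl.1 hi)]
  omega

theorem downSum_eq_zero_of_card_ne {s : ℕ} {f : Finset α → ℝ}
    (hf : ∀ B, B.card ≠ s → f B = 0) {A : Finset α} (hA : A.card ≠ s + 1) :
    downSum f A = 0 := by
  refine Finset.sum_eq_zero fun i hi => hf _ ?_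
  rw [Finset.card_erase_of_mem hi]
  have := Finset.card_pos.2 ⟨i, hi⟩
  omega

/-- On the level `s`, with `2 * s < |α|`, the operator `upSum ∘ downSum` is onto. -/
theorem exists_upSum_downSum_eq {s : ℕ} (hs : 2 * s < Fintype.card α) {g : Finset α → ℝ}
    (hg : ∀ B, B.card ≠ s → g B = 0) :
    ∃ f : Finset α → ℝ, (∀ B, B.card ≠ s → f B = 0) ∧ upSum (downSum f) = g := by
  let L : Submodule ℝ (Finset α → ℝ) :=
    { carrier := {f | ∀ B, B.card ≠ s → f B = 0}
      add_mem' := fun {a b} ha hb B h => by simp [ha B h, hb B h]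
      zero_mem' := fun B _ => rfl
      smul_mem' := fun c f hf B h => by simp [hf B h] }
  let T : L →ₗ[ℝ] L :=
    { toFun := fun f => ⟨upSum (downSum f.1), fun B hB => upSum_eq_zero_of_card_ne
        (fun A hA => downSum_eq_zero_of_card_ne f.2 hA) hB⟩
      map_add' := fun f g => by
        ext B; simp [upSum, downSum, Finset.sum_add_distrib]
      map_smul' := fun c f => by
        ext B; simp [upSum, downSum, Finset.mul_sum] }
  have hinj : Function.Injective T := by
    rw [← LinearMap.ker_eq_bot, LinearMap.ker_eq_bot']
    intro f hf
    have h0 : upSum (downSum f.1) = 0 := congrArg Subtype.val hf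
    have h1 : ∑ A, downSum f.1 A ^ 2 = 0 := by
      simp only [sq]
      rw [sum_mul_downSum, h0]
      simp
    rw [sum_sq_downSum f.2] at h1
    have h2 : (0 : ℝ) < (Fintype.card α : ℝ) - 2 * s := by
      rw [sub_pos]; exact_mod_cast hs
    have h3 : 0 ≤ ∑ B, upSum f.1 B ^ 2 := Finset.sum_nonneg fun _ _ => sq_nonneg _
    have h4 : 0 ≤ ∑ B, f.1 B ^ 2 := Finset.sum_nonneg fun _ _ => sq_nonneg _
    have h5 : ∑ B, f.1 B ^ 2 = 0 := by nlinarith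
    rw [Finset.sum_eq_zero_iff_of_nonneg fun _ _ => sq_nonneg _] at h5
    ext B
    simpa using h5 B (Finset.mem_univ B)
  obtain ⟨f, hf⟩ := LinearMap.injective_iff_surjective.1 hinj ⟨g, hg⟩
  exact ⟨f.1, f.2, congrArg Subtype.val hf⟩

/-- A point mass on the level `s + 1` is the sum of an element of the kernel of `upSum` and
of a short vector. -/
theorem exists_decomposition_single {s : ℕ} (hs : 2 * s < Fintype.card α) {z : Finset α}
    (hz : z.card = s + 1) :
    ∃ u w : Finset α → ℝ, (∀ B, B.card ≠ s + 1 → u B = 0) ∧ (∀ B, B.card ≠ s + 1 → w B = 0) ∧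
      (∀ A, u A + w A = if A = z then 1 else 0) ∧ upSum u = 0 ∧ ∑ A, u A ^ 2 ≤ 1 ∧
      ∑ A, w A ^ 2 ≤ ((s : ℝ) + 1) / ((Fintype.card α : ℝ) - 2 * s) := by
  set e : Finset α → ℝ := fun A => if A = z then 1 else 0 with he
  have hel : ∀ B, B.card ≠ s + 1 → e B = 0 := by
    intro B hB
    simp only [he]
    rw [if_neg]
    rintro rfl
    exact hB hz
  -- Normal equations: `downSum y` is the orthogonal projection of `e` onto the image of level `s`,
  -- whose complement in level `s + 1` is the kernel of `upSum`.
  obtain ⟨y, hy, hyz⟩ := exists_upSum_downSum_eq hs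
    (g := upSum e) (fun B hB => upSum_eq_zero_of_card_ne hel hB)
  have hwl : ∀ B, B.card ≠ s + 1 → downSum y B = 0 := fun B hB =>
    downSum_eq_zero_of_card_ne hy hB
  have hu0 : upSum (fun A => e A - downSum y A) = 0 := by
    ext B
    have := congrFun hyz B
    simp only [upSum, Finset.sum_sub_distrib, Pi.zero_apply] at this ⊢
    linarith
  have hee : ∑ A, e A ^ 2 = 1 := by simp [he]
  have hce : ∑ B, upSum e B ^ 2 = (s : ℝ) + 1 := by
    have h1 : ∀ B, upSum e B ^ 2 = upSum e B * upSum e B := fun B => sq _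
    simp only [h1]
    rw [← sum_mul_downSum]
    have h2 : ∑ A, e A * downSum (upSum e) A = downSum (upSum e) z := by simp [he]
    rw [h2, downSum]
    have h3 : ∀ i ∈ z, upSum e (z.erase i) = 1 := by
      intro i hi
      rw [upSum, Finset.sum_eq_single i]
      · simp [he, Finset.insert_erase hi]
      · intro j hj hji
        simp only [he]
        rw [if_neg]
        intro h
        have : i ∈ insert j (z.erase i) := by rw [h]; exact hi
        simp [hji.symm] at this
      · simp
    rw [Finset.sum_congr rfl h3]
    simp [hz]
  have horth : ∑ A, (e A - downSum y A) * downSum y A = 0 := by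
    rw [sum_mul_downSum (fun A => e A - downSum y A) y, hu0]
    simp
  refine ⟨fun A => e A - downSum y A, downSum y, fun B hB => by simp [hel B hB, hwl B hB], hwl,
    fun A => by simp [he], hu0, ?_, ?_⟩
  · have h1 : ∑ A, e A ^ 2 = ∑ A, (e A - downSum y A) ^ 2 +
        2 * ∑ A, (e A - downSum y A) * downSum y A + ∑ A, downSum y A ^ 2 := by
      rw [Finset.mul_sum, ← Finset.sum_add_distrib, ← Finset.sum_add_distrib]
      exact Finset.sum_congr rfl fun A _ => by ring
    have h2 : 0 ≤ ∑ A, downSum y A ^ 2 := Finset.sum_nonneg fun _ _ => sq_nonneg _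
    linarith
  · have hc : (0 : ℝ) < (Fintype.card α : ℝ) - 2 * s := by
      rw [sub_pos]; exact_mod_cast hs
    have h1 : ∑ A, downSum y A ^ 2 = ∑ B, upSum e B * y B := by
      simp only [sq]
      rw [sum_mul_downSum, hyz]
    -- With `w = downSum y`: `‖w‖⁴ ≤ (s + 1) ‖y‖²` and `(|α| - 2s) ‖y‖² ≤ ‖w‖²`; cancel one factor
    -- `‖w‖²`.
    have h2 : (∑ B, upSum e B * y B) ^ 2 ≤ (∑ B, upSum e B ^ 2) * ∑ B, y B ^ 2 :=
      Finset.sum_mul_sq_le_sq_mul_sq _ _ _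
    have h3 : ((Fintype.card α : ℝ) - 2 * s) * ∑ B, y B ^ 2 ≤ ∑ A, downSum y A ^ 2 := by
      rw [sum_sq_downSum hy]
      linarith [Finset.sum_nonneg fun B (_ : B ∈ Finset.univ) => sq_nonneg (upSum y B)]
    rw [← h1, hce] at h2
    rw [le_div_iff₀ hc]
    have h4 : 0 ≤ ∑ A, downSum y A ^ 2 := Finset.sum_nonneg fun _ _ => sq_nonneg _
    rcases h4.eq_or_lt with h5 | h5
    · rw [← h5, zero_mul]; positivity
    · refine le_of_mul_le_mul_right ?_ h5
      nlinarith [mul_le_mul_of_nonneg_left h3 (show (0 : ℝ) ≤ s + 1 by positivity),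
        mul_le_mul_of_nonneg_left h2 hc.le]

/-- A function on the level `s + 1` in the kernel of `upSum` sums to zero over all sets that
contain a given set of size at most `s`. -/
theorem sum_superset_eq_zero {s : ℕ} {u : Finset α → ℝ}
    (hu : ∀ B, B.card ≠ s + 1 → u B = 0) (hu0 : upSum u = 0) (d : ℕ) :
    ∀ B : Finset α, B.card + d = s → ∑ A, (if B ⊆ A then u A else 0) = 0 := by
  -- Double counting: each `A ⊇ B` of size `s + 1` is reached through `s + 1 - |B|` elements `i`.
  -- This factor is nonzero, so vanishing descends from larger `B`.
  have step : ∀ B : Finset α,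
      ∑ i ∈ Bᶜ, ∑ A, (if insert i B ⊆ A then u A else 0) =
        ((s : ℝ) + 1 - B.card) * ∑ A, (if B ⊆ A then u A else 0) := by
    intro B
    rw [Finset.sum_comm, Finset.mul_sum]
    refine Finset.sum_congr rfl fun A _ => ?_
    by_cases hA : A.card = s + 1
    · by_cases hBA : B ⊆ A
      · have h1 : ∀ i ∈ Bᶜ, (if insert i B ⊆ A then u A else 0) = if i ∈ A then u A else 0 := by
          intro i _
          simp [Finset.insert_subset_iff, hBA]
        have h2 : Bᶜ.filter (· ∈ A) = A \ B := by
          ext x; simp [and_comm]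
        rw [Finset.sum_congr rfl h1, ← Finset.sum_filter, h2, Finset.sum_const,
          Finset.card_sdiff_of_subset hBA, nsmul_eq_mul,
          Nat.cast_sub (Finset.card_le_card hBA), hA]
        simp [hBA]
      · simp [Finset.insert_subset_iff, hBA]
    · simp [hu A hA]
  induction d with
  | zero =>
    intro B hB
    have h := step B
    have h1 : ∀ i ∈ Bᶜ, ∑ A, (if insert i B ⊆ A then u A else 0) = u (insert i B) := by
      intro i hi
      rw [Finset.sum_eq_single (insert i B)]
      · simp
      · intro A _ hA
        by_cases hc : A.card = s + 1
        · rw [if_neg]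
          intro hsub
          refine hA (Finset.eq_of_subset_of_card_le hsub ?_).symm
          rw [Finset.card_insert_of_notMem (Finset.mem_compl.1 hi)]
          omega
        · simp [hu A hc]
      · simp
    rw [Finset.sum_congr rfl h1] at h
    have h2 : ∑ i ∈ Bᶜ, u (insert i B) = 0 := congrFun hu0 B
    rw [h2] at h
    have h3 : (s : ℝ) + 1 - B.card ≠ 0 := by
      have : (s : ℝ) = B.card := by exact_mod_cast hB.symm
      rw [this]; norm_num
    exact (mul_eq_zero.1 h.symm).resolve_left h3
  | succ d ih =>
    intro B hB
    have h := step B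
    rw [Finset.sum_eq_zero fun i hi => ih (insert i B) (by
      rw [Finset.card_insert_of_notMem (Finset.mem_compl.1 hi)]; omega)] at h
    have h3 : (s : ℝ) + 1 - B.card ≠ 0 := by
      have : (s : ℝ) = B.card + (d + 1) := by exact_mod_cast hB.symm
      rw [this, show (B.card : ℝ) + (d + 1) + 1 - B.card = d + 2 by ring]
      positivity
    exact (mul_eq_zero.1 h.symm).resolve_left h3

open fwdDiff in
/-- The quadratic form of the kernel `f (y + |A ∩ A'|)` on the kernel of `upSum` in the
level `s + 1`. -/
theorem sum_kernel_inter_eq {s : ℕ} {u : Finset α → ℝ}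
    (hu : ∀ B, B.card ≠ s + 1 → u B = 0) (hu0 : upSum u = 0) (f : ℕ → ℝ) (y : ℕ) :
    ∑ A, ∑ A', u A * u A' * f (y + (A ∩ A').card) =
      (Δ_[1])^[s + 1] f y * ∑ A, u A ^ 2 := by
  -- Newton expansion at `y`, with `|A ∩ A'|` choose `j` counting the common `j`-subsets `B`. Summed
  -- over `A, A'`, level `j` becomes a sum of squares of superset sums, which vanish for `j ≤ s`.
  have hnewton : ∀ A A' : Finset α, u A * u A' * f (y + (A ∩ A').card) =
      ∑ j ∈ Finset.range (s + 2), (Δ_[1])^[j] f y * ∑ B ∈ Finset.univ.filter (fun B => B.card = j),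
        (if B ⊆ A then u A else 0) * (if B ⊆ A' then u A' else 0) := by
    intro A A'
    by_cases hA : A.card = s + 1
    swap
    · simp [hu A hA]
    have hle : (A ∩ A').card ≤ s + 1 := hA ▸ Finset.card_le_card Finset.inter_subset_left
    have h1 := shift_eq_sum_fwdDiff_iter 1 f (A ∩ A').card y
    simp only [smul_eq_mul, mul_one, nsmul_eq_mul] at h1
    have h2 : f (y + (A ∩ A').card) =
        ∑ j ∈ Finset.range (s + 2), ((A ∩ A').card.choose j : ℝ) * (Δ_[1])^[j] f y := by
      rw [h1]
      refine Finset.sum_subset (Finset.range_mono (by omega)) fun j _ hj => ?_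
      rw [Nat.choose_eq_zero_of_lt (by simpa using hj)]
      simp
    rw [h2, Finset.mul_sum]
    refine Finset.sum_congr rfl fun j _ => ?_
    have h3 : ∀ B : Finset α, (if B ⊆ A then u A else 0) * (if B ⊆ A' then u A' else 0) =
        if B ⊆ A ∩ A' then u A * u A' else 0 := by
      intro B
      by_cases h : B ⊆ A <;> by_cases h' : B ⊆ A' <;> simp [Finset.subset_inter_iff, h, h']
    simp only [h3]
    rw [← Finset.sum_filter, Finset.filter_filter, Finset.sum_const]
    have h4 : (Finset.univ.filter fun B : Finset α => B.card = j ∧ B ⊆ A ∩ A') =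
        Finset.powersetCard j (A ∩ A') := by
      ext B; simp [Finset.mem_powersetCard, and_comm]
    rw [h4, Finset.card_powersetCard, nsmul_eq_mul]
    ring
  simp only [hnewton]
  have hswap : ∑ A, ∑ A', ∑ j ∈ Finset.range (s + 2), (Δ_[1])^[j] f y *
        ∑ B ∈ Finset.univ.filter (fun B : Finset α => B.card = j),
          (if B ⊆ A then u A else 0) * (if B ⊆ A' then u A' else 0) =
      ∑ j ∈ Finset.range (s + 2), (Δ_[1])^[j] f y *
        ∑ B ∈ Finset.univ.filter (fun B : Finset α => B.card = j),
          (∑ A, if B ⊆ A then u A else 0) ^ 2 := by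
    have h1 : ∀ B : Finset α, (∑ A, if B ⊆ A then u A else 0) ^ 2 =
        ∑ A, ∑ A', (if B ⊆ A then u A else 0) * (if B ⊆ A' then u A' else 0) := by
      intro B
      rw [sq, Finset.sum_mul_sum]
    simp only [h1]
    rw [Finset.sum_congr rfl fun A _ => Finset.sum_comm, Finset.sum_comm]
    refine Finset.sum_congr rfl fun j _ => ?_
    simp only [← Finset.mul_sum]
    congr 1
    rw [Finset.sum_congr rfl fun A _ => Finset.sum_comm, Finset.sum_comm]
    simp only [Finset.mul_sum]
  rw [hswap, Finset.sum_range_succ, Finset.sum_eq_zero, zero_add]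
  · congr 1
    rw [Finset.sum_filter]
    refine Finset.sum_congr rfl fun B _ => ?_
    by_cases hB : B.card = s + 1
    · rw [if_pos hB, Finset.sum_eq_single B]
      · simp
      · intro A _ hA
        by_cases hc : A.card = s + 1
        · rw [if_neg]
          intro hsub
          exact hA (Finset.eq_of_subset_of_card_le hsub (by omega)).symm
        · simp [hu A hc]
      · simp
    · simp [hB, hu B hB]
  · intro j hj
    rw [Finset.sum_eq_zero, mul_zero]
    intro B hB
    rw [Finset.mem_filter] at hB
    rw [Finset.mem_range] at hj
    rw [sum_superset_eq_zero hu hu0 (s - j) B (by omega)]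
    simp

end Boolean

/-! ### Measurements and nearly indistinguishable states -/

/-- A bound on the success probability of measurements, in terms of the Gram matrix `G` of the
states: each point mass is a sum of a vector `u` on which `G` is small and a short vector `w`. -/
theorem sum_norm_sq_le_of_decomposition {X ι O : Type*} [Fintype X] [DecidableEq X] [Fintype ι]
    [Fintype O] (b : O → ι → X → ℂ) (G : X → X → ℝ)
    (hG : ∀ u : X → ℝ, ∑ a, ∑ i, ‖∑ x, (u x : ℂ) * b a i x‖ ^ 2 = ∑ x, ∑ y, u x * u y * G x y)
    (F : Finset X) (o : X → O) (ho : Set.InjOn o F) (hdiag : ∀ x ∈ F, G x x = 1)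
    (l μ : ℝ) (hμ : 0 ≤ μ)
    (hdec : ∀ z ∈ F, ∃ u w : X → ℝ, (∀ x, x ∉ F → w x = 0) ∧
      (∀ x, u x + w x = if x = z then 1 else 0) ∧
      ∑ x, ∑ y, u x * u y * G x y ≤ l ∧ ∑ x, w x ^ 2 ≤ μ) :
    ∑ z ∈ F, ∑ i, ‖b (o z) i z‖ ^ 2 ≤ (F.card : ℝ) * (5 / 4 * l + 5 * μ) := by
  -- The `w` part keeps the mass of all states at outcome `o z`, so that summing over `z` costs at
  -- most one unit per state (`htot`).
  have hone : ∀ z ∈ F, ∑ i, ‖b (o z) i z‖ ^ 2 ≤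
      5 / 4 * l + 5 * (μ * ∑ i, ∑ x ∈ F, ‖b (o z) i x‖ ^ 2) := by
    intro z hz
    obtain ⟨u, w, hw, huw, hu, hwμ⟩ := hdec z hz
    have h1 : ∑ i, ‖∑ x, (u x : ℂ) * b (o z) i x‖ ^ 2 ≤ l := by
      refine le_trans ?_ hu
      rw [← hG u]
      exact Finset.single_le_sum (f := fun a => ∑ i, ‖∑ x, (u x : ℂ) * b a i x‖ ^ 2)
        (fun a _ => Finset.sum_nonneg fun i _ => sq_nonneg _) (Finset.mem_univ (o z))
    have h2 : ∀ i, ‖∑ x, (w x : ℂ) * b (o z) i x‖ ^ 2 ≤ μ * ∑ x ∈ F, ‖b (o z) i x‖ ^ 2 := by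
      intro i
      have h3 : ∑ x, (w x : ℂ) * b (o z) i x = ∑ x ∈ F, (w x : ℂ) * b (o z) i x :=
        (Finset.sum_subset (Finset.subset_univ F) fun x _ hx => by simp [hw x hx]).symm
      rw [h3]
      calc ‖∑ x ∈ F, (w x : ℂ) * b (o z) i x‖ ^ 2
          ≤ (∑ x ∈ F, |w x| * ‖b (o z) i x‖) ^ 2 := by
            gcongr
            refine (norm_sum_le _ _).trans (le_of_eq ?_)
            simp
        _ ≤ (∑ x ∈ F, |w x| ^ 2) * ∑ x ∈ F, ‖b (o z) i x‖ ^ 2 :=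
            Finset.sum_mul_sq_le_sq_mul_sq _ _ _
        _ ≤ _ := by
            refine mul_le_mul_of_nonneg_right ?_ (Finset.sum_nonneg fun _ _ => sq_nonneg _)
            refine le_trans ?_ hwμ
            simp only [sq_abs]
            exact Finset.sum_le_sum_of_subset_of_nonneg (Finset.subset_univ F)
              fun _ _ _ => sq_nonneg _
    have h4 : ∀ i, ‖b (o z) i z‖ ^ 2 ≤ 5 / 4 * ‖∑ x, (u x : ℂ) * b (o z) i x‖ ^ 2 +
        5 * ‖∑ x, (w x : ℂ) * b (o z) i x‖ ^ 2 := by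
      intro i
      have h5 : b (o z) i z =
          ∑ x, (u x : ℂ) * b (o z) i x + ∑ x, (w x : ℂ) * b (o z) i x := by
        rw [← Finset.sum_add_distrib]
        simp only [← add_mul, ← Complex.ofReal_add, huw]
        simp [apply_ite Complex.ofReal]
      have h6 := norm_add_le (∑ x, (u x : ℂ) * b (o z) i x) (∑ x, (w x : ℂ) * b (o z) i x)
      rw [← h5] at h6
      have h7 := norm_nonneg (b (o z) i z)
      -- `5/4 a² + 5 b² - (a + b)² = (a - 4b)² / 4`.
      nlinarith [sq_nonneg (‖∑ x, (u x : ℂ) * b (o z) i x‖ -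
        4 * ‖∑ x, (w x : ℂ) * b (o z) i x‖)]
    calc ∑ i, ‖b (o z) i z‖ ^ 2
        ≤ ∑ i, (5 / 4 * ‖∑ x, (u x : ℂ) * b (o z) i x‖ ^ 2 +
            5 * (μ * ∑ x ∈ F, ‖b (o z) i x‖ ^ 2)) :=
          Finset.sum_le_sum fun i _ => (h4 i).trans (by gcongr; exact h2 i)
      _ ≤ _ := by
          rw [Finset.sum_add_distrib, ← Finset.mul_sum, ← Finset.mul_sum, ← Finset.mul_sum]
          gcongr
  have htot : ∑ z ∈ F, ∑ i, ∑ x ∈ F, ‖b (o z) i x‖ ^ 2 ≤ F.card := by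
    have h1 : ∀ x ∈ F, ∑ a, ∑ i, ‖b a i x‖ ^ 2 = 1 := by
      intro x hx
      have h2 := hG (fun y => if y = x then 1 else 0)
      simpa [hdiag x hx, apply_ite Complex.ofReal] using h2
    classical
    calc ∑ z ∈ F, ∑ i, ∑ x ∈ F, ‖b (o z) i x‖ ^ 2
        = ∑ a ∈ F.image o, ∑ i, ∑ x ∈ F, ‖b a i x‖ ^ 2 := by
          rw [Finset.sum_image ho]
      _ ≤ ∑ a, ∑ i, ∑ x ∈ F, ‖b a i x‖ ^ 2 :=
          Finset.sum_le_sum_of_subset_of_nonneg (Finset.subset_univ _) fun _ _ _ =>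
            Finset.sum_nonneg fun _ _ => Finset.sum_nonneg fun _ _ => sq_nonneg _
      _ = ∑ x ∈ F, ∑ a, ∑ i, ‖b a i x‖ ^ 2 := by
          rw [Finset.sum_congr rfl fun a _ => Finset.sum_comm, Finset.sum_comm]
      _ = F.card := by
          rw [Finset.sum_congr rfl h1]; simp
  calc ∑ z ∈ F, ∑ i, ‖b (o z) i z‖ ^ 2
      ≤ ∑ z ∈ F, (5 / 4 * l + 5 * (μ * ∑ i, ∑ x ∈ F, ‖b (o z) i x‖ ^ 2)) :=
        Finset.sum_le_sum hone
    _ = F.card * (5 / 4 * l) + 5 * (μ * ∑ z ∈ F, ∑ i, ∑ x ∈ F, ‖b (o z) i x‖ ^ 2) := by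
        rw [Finset.sum_add_distrib, Finset.sum_const, nsmul_eq_mul, ← Finset.mul_sum,
          ← Finset.mul_sum]
    _ ≤ F.card * (5 / 4 * l) + 5 * (μ * F.card) := by gcongr
    _ = _ := by ring

/-! ### Born probabilities and the Gram matrix of the samples -/

theorem mulVec_conjTranspose_mul_self_dotProduct_star {ι : Type*} [Fintype ι]
    (B : Matrix ι ι ℂ) (v : ι → ℂ) :
    Matrix.mulVec (B.conjTranspose * B) v ⬝ᵥ star v =
      ((∑ i, ‖Matrix.mulVec B v i‖ ^ 2 : ℝ) : ℂ) := by
  rw [← Matrix.mulVec_mulVec, dotProduct_comm, Matrix.dotProduct_mulVec, ← Matrix.star_mulVec,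
    dotProduct_comm]
  simp only [dotProduct, Pi.star_apply]
  push_cast
  refine Finset.sum_congr rfl fun i _ => ?_
  exact Complex.mul_conj' _

open scoped MatrixOrder in
theorem Matrix.PosSemidef.exists_eq_conjTranspose_mul_self {ι : Type*} [Fintype ι]
    [DecidableEq ι] {M : Matrix ι ι ℂ} (hM : M.PosSemidef) :
    ∃ B : Matrix ι ι ℂ, M = B.conjTranspose * B :=
  CStarAlgebra.nonneg_iff_eq_star_mul_self.mp hM.nonneg

theorem QuantumMeasurement.sum_prob {ι α : Type} [Fintype ι] [DecidableEq ι] [Fintype α]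
    (M : QuantumMeasurement ι α) (ρ : Matrix ι ι ℂ) :
    ∑ a, M.prob ρ a = (Matrix.trace ρ).re := by
  simp only [QuantumMeasurement.prob]
  rw [← Complex.re_sum, ← Matrix.trace_sum, ← Finset.sum_mul, M.sum_eq_one, one_mul]

theorem QuantumMeasurement.prob_vecMulVec {ι α : Type} [Fintype ι] [DecidableEq ι] [Fintype α]
    (M : QuantumMeasurement ι α) {a : α} {B : Matrix ι ι ℂ} (hB : M.op a = B.conjTranspose * B)
    (v : ι → ℂ) :
    M.prob (Matrix.vecMulVec v (star v)) a = ∑ i, ‖Matrix.mulVec B v i‖ ^ 2 := by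
  rw [QuantumMeasurement.prob, Matrix.mul_vecMulVec, Matrix.trace_vecMulVec, hB,
    mulVec_conjTranspose_mul_self_dotProduct_star, Complex.ofReal_re]

theorem QuantumMeasurement.sum_sum_norm_sq {ι α : Type} [Fintype ι] [DecidableEq ι] [Fintype α]
    (M : QuantumMeasurement ι α) {B : α → Matrix ι ι ℂ}
    (hB : ∀ a, M.op a = (B a).conjTranspose * B a) (v : ι → ℂ) :
    ∑ a, ∑ i, ‖Matrix.mulVec (B a) v i‖ ^ 2 = ∑ i, ‖v i‖ ^ 2 := by
  rw [← Finset.sum_congr rfl fun a _ => M.prob_vecMulVec (hB a) v, M.sum_prob,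
    Matrix.trace_vecMulVec]
  simp only [dotProduct, Pi.star_apply, Complex.re_sum]
  refine Finset.sum_congr rfl fun i _ => ?_
  have : v i * star (v i) = ((‖v i‖ ^ 2 : ℝ) : ℂ) := by
    push_cast; exact Complex.mul_conj' _
  rw [this, Complex.ofReal_re]

/-- The real amplitudes of `quantumSamples`. -/
noncomputable def sampleAmplitude {n : ℕ} (t : ℕ) (S : Finset (Fin n)) (x : Fin t → Fin n) : ℝ :=
  ∏ j, if x j ∈ S then 1 / Real.sqrt (S.card : ℝ) else 0

theorem quantumSamples_eq_ofReal {n : ℕ} (t : ℕ) (S : Finset (Fin n)) (x : Fin t → Fin n) :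
    quantumSamples t S x = (sampleAmplitude t S x : ℂ) := by
  simp only [quantumSamples, quantumSample, sampleAmplitude]
  rw [Complex.ofReal_prod]
  refine Finset.prod_congr rfl fun j _ => ?_
  split_ifs <;> simp

theorem sum_sampleAmplitude_mul {n k : ℕ} (t : ℕ) {S S' : Finset (Fin n)} (hS : S.card = k)
    (hS' : S'.card = k) :
    ∑ x, sampleAmplitude t S x * sampleAmplitude t S' x = (((S ∩ S').card : ℝ) / k) ^ t := by
  simp only [sampleAmplitude, ← Finset.prod_mul_distrib, hS, hS']
  rw [← Fintype.prod_sum (fun (_ : Fin t) (i : Fin n) =>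
    (if i ∈ S then 1 / Real.sqrt (k : ℝ) else 0) * if i ∈ S' then 1 / Real.sqrt (k : ℝ) else 0),
    Finset.prod_const, Finset.card_univ, Fintype.card_fin]
  congr 1
  have h : ∀ i : Fin n, (if i ∈ S then 1 / Real.sqrt (k : ℝ) else 0) *
      (if i ∈ S' then 1 / Real.sqrt (k : ℝ) else 0) = if i ∈ S ∩ S' then 1 / (k : ℝ) else 0 := by
    intro i
    by_cases h1 : i ∈ S <;> by_cases h2 : i ∈ S' <;> simp [h1, h2]
    rw [← mul_inv, Real.mul_self_sqrt (Nat.cast_nonneg k)]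
  rw [Finset.sum_congr rfl fun i _ => h i, Finset.sum_ite_mem]
  simp [div_eq_mul_inv]

theorem CouponLearner.one_sub_errorProb {n k t : ℕ} (hk : 0 < k) (A : CouponLearner n t)
    {S : Finset (Fin n)} (hS : S.card = k) :
    1 - A.errorProb S = A.prob (quantumSamplesState t S) S := by
  have h1 : ∑ S', A.prob (quantumSamplesState t S) S' = 1 := by
    rw [A.sum_prob, quantumSamplesState, Matrix.trace_vecMulVec]
    simp only [dotProduct, Pi.star_apply, quantumSamples_eq_ofReal, RCLike.star_def,
      Complex.conj_ofReal, ← Complex.ofReal_mul, ← Complex.ofReal_sum, Complex.ofReal_re]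
    rw [sum_sampleAmplitude_mul t hS hS, Finset.inter_self, hS,
      div_self (by exact_mod_cast hk.ne'), one_pow]
  rw [CouponLearner.errorProb, Finset.filter_ne', ← h1,
    ← Finset.add_sum_erase _ _ (Finset.mem_univ S)]
  ring

/-- Averages the success probability over all sets that omit `s + 1` of the first `k + s + 1`
coupons. Here `|α| - 2s = k + 1 - s`. -/
theorem CouponLearner.Solves.one_sub_le {n k s t : ℕ} {δ : ℝ} {A : CouponLearner n t}
    (hA : A.Solves k δ) (hs : s < k) (hn : k + s + 1 ≤ n) :
    1 - δ ≤ 5 / 4 * (1 - (1 - 1 / (k : ℝ)) ^ t) ^ (s + 1) +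
      5 * (((s : ℝ) + 1) / ((k : ℝ) + 1 - s)) := by
  classical
  have hk : 0 < k := by omega
  choose B hB using fun a => (A.posSemidef a).exists_eq_conjTranspose_mul_self
  let o : Finset (Fin (k + s + 1)) → Finset (Fin n) := fun z => zᶜ.map (Fin.castLEEmb hn)
  let F : Finset (Finset (Fin (k + s + 1))) := Finset.univ.filter fun z => z.card = s + 1
  have hF : ∀ z, z ∈ F ↔ z.card = s + 1 := fun z => by simp [F]
  have ho : Function.Injective o := fun a b hab =>
    compl_injective (Finset.map_injective _ hab)
  have hcard : ∀ z ∈ F, (o z).card = k := by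
    intro z hz
    rw [hF] at hz
    simp only [o, Finset.card_map, Finset.card_compl, Fintype.card_fin, hz]
    omega
  have hinter : ∀ z ∈ F, ∀ z' ∈ F, (o z ∩ o z').card = k - (s + 1) + (z ∩ z').card := by
    intro z hz z' hz'
    rw [hF] at hz hz'
    have h1 := Finset.card_union_add_card_inter z z'
    have h2 := Finset.card_le_univ (z ∪ z')
    have h3 : (z ∩ z').card ≤ s + 1 := hz ▸ Finset.card_le_card Finset.inter_subset_left
    simp only [Fintype.card_fin] at h2
    simp only [o]
    rw [← Finset.map_inter, ← Finset.compl_union, Finset.card_map, Finset.card_compl,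
      Fintype.card_fin]
    omega
  let G : Finset (Fin (k + s + 1)) → Finset (Fin (k + s + 1)) → ℝ := fun z z' =>
    ∑ x, sampleAmplitude t (o z) x * sampleAmplitude t (o z') x
  have hGF : ∀ z ∈ F, ∀ z' ∈ F,
      G z z' = ((((k - (s + 1) + (z ∩ z').card : ℕ) : ℝ)) / k) ^ t := by
    intro z hz z' hz'
    rw [← hinter z hz z' hz']
    exact sum_sampleAmplitude_mul t (hcard z hz) (hcard z' hz')
  have hc0 : (0 : ℝ) < (k : ℝ) + 1 - s := by
    have : (s : ℝ) < k := by exact_mod_cast hs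
    linarith
  have hcα : (Fintype.card (Fin (k + s + 1)) : ℝ) - 2 * s = (k : ℝ) + 1 - s := by
    rw [Fintype.card_fin]; push_cast; ring
  have key := sum_norm_sq_le_of_decomposition
    (fun a i z => Matrix.mulVec (B a) (quantumSamples t (o z)) i) G ?_ F o ho.injOn ?_
    ((1 - (1 - 1 / (k : ℝ)) ^ t) ^ (s + 1)) (((s : ℝ) + 1) / ((k : ℝ) + 1 - s))
    (by positivity) ?_
  · have h1 : ∀ z ∈ F, 1 - δ ≤
        ∑ i, ‖Matrix.mulVec (B (o z)) (quantumSamples t (o z)) i‖ ^ 2 := by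
      intro z hz
      rw [← A.prob_vecMulVec (hB (o z)), ← quantumSamplesState,
        ← A.one_sub_errorProb hk (hcard z hz)]
      linarith [hA (o z) (hcard z hz)]
    have h2 := (Finset.card_nsmul_le_sum F _ _ h1).trans key
    rw [nsmul_eq_mul] at h2
    refine le_of_mul_le_mul_left h2 ?_
    obtain ⟨z, -, hz⟩ := Finset.exists_subset_card_eq
      (s := (Finset.univ : Finset (Fin (k + s + 1)))) (n := s + 1) (by simp)
    exact_mod_cast Finset.card_pos.2 ⟨z, (hF z).2 hz⟩
  · intro u
    have h1 : ∀ a i, ∑ z, (u z : ℂ) * Matrix.mulVec (B a) (quantumSamples t (o z)) i =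
        Matrix.mulVec (B a) (fun x => ((∑ z, u z * sampleAmplitude t (o z) x : ℝ) : ℂ)) i := by
      intro a i
      simp only [Matrix.mulVec, dotProduct, quantumSamples_eq_ofReal, Finset.mul_sum,
        Complex.ofReal_sum, Complex.ofReal_mul]
      rw [Finset.sum_comm]
      exact Finset.sum_congr rfl fun _ _ => Finset.sum_congr rfl fun _ _ => by ring
    simp only [h1]
    rw [A.sum_sum_norm_sq hB]
    simp only [Complex.norm_real, Real.norm_eq_abs, sq_abs, G, Finset.mul_sum]
    simp only [sq, Finset.sum_mul_sum]
    rw [Finset.sum_comm, Finset.sum_congr rfl fun z _ => Finset.sum_comm]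
    exact Finset.sum_congr rfl fun _ _ => Finset.sum_congr rfl fun _ _ =>
      Finset.sum_congr rfl fun _ _ => by ring
  · intro z hz
    simp only [G]
    rw [sum_sampleAmplitude_mul t (hcard z hz) (hcard z hz), Finset.inter_self, hcard z hz,
      div_self (by exact_mod_cast hk.ne'), one_pow]
  · intro z hz
    obtain ⟨u, w, hu, hw, huw, hu0, hu1, hw1⟩ := exists_decomposition_single
      (s := s) (by rw [Fintype.card_fin]; omega) ((hF z).1 hz)
    rw [hcα] at hw1
    refine ⟨u, w, fun x hx => hw x (fun h => hx ((hF x).2 h)), huw, ?_, hw1⟩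
    have h1 : ∑ x, ∑ y, u x * u y * G x y = ∑ x, ∑ y, u x * u y *
        (fun x : ℕ => ((x : ℝ) / k) ^ t) (k - (s + 1) + (x ∩ y).card) := by
      refine Finset.sum_congr rfl fun x _ => Finset.sum_congr rfl fun y _ => ?_
      by_cases hx : x ∈ F
      · by_cases hy : y ∈ F
        · rw [hGF x hx y hy]
        · simp [hu y (fun h => hy ((hF y).2 h))]
      · simp [hu x (fun h => hx ((hF x).2 h))]
    rw [h1, sum_kernel_inter_eq hu hu0 (fun x : ℕ => ((x : ℝ) / k) ^ t)]
    obtain ⟨h2, h3⟩ := fwdDiff_iter_div_pow_mem_Icc hk t (s + 1) (k - (s + 1)) (by omega)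
    exact (mul_le_of_le_one_right h2 hu1).trans h3

/-! ### Numerical estimates and the choice of `s` -/

/-- At the worst `q` the base is `(1 + 1/r)⁻¹`; Bernoulli gives `(1 + 1/r)^r ≥ 2`. -/
theorem one_sub_pow_le_half {r : ℕ} (hr : 0 < r) {q : ℝ} (hq : 1 / ((r : ℝ) + 1) ≤ q)
    (hq1 : q ≤ 1) : (1 - q) ^ r ≤ 1 / 2 := by
  have hr0 : (0 : ℝ) < r := by exact_mod_cast hr
  have h1 : (1 - q) ^ r ≤ (1 + 1 / (r : ℝ))⁻¹ ^ r := by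
    refine pow_le_pow_left₀ (by linarith) ?_ r
    have : (1 + 1 / (r : ℝ))⁻¹ = 1 - 1 / ((r : ℝ) + 1) := by field_simp; ring
    linarith
  have h2 : (2 : ℝ) ≤ (1 + 1 / (r : ℝ)) ^ r := by
    have h3 := one_add_mul_le_pow (a := 1 / (r : ℝ)) (by
      have : (0 : ℝ) ≤ 1 / r := by positivity
      linarith) r
    have h4 : 1 + (r : ℝ) * (1 / r) = 2 := by field_simp; norm_num
    linarith
  rw [inv_pow] at h1
  refine h1.trans ?_
  rw [one_div (2 : ℝ)]
  exact inv_anti₀ (by norm_num) h2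

/-- The factor `k - 1` comes from `log (1 - 1/k) ≥ -1/(k - 1)`. -/
theorem inv_le_one_sub_inv_pow {k : ℕ} (hk : 1 < k) {t : ℕ} {x : ℝ} (hx : 0 < x)
    (ht : (t : ℝ) ≤ ((k : ℝ) - 1) * Real.log x) : 1 / x ≤ (1 - 1 / (k : ℝ)) ^ t := by
  have hk1 : (1 : ℝ) < k := by exact_mod_cast hk
  have hp : 0 < 1 - 1 / (k : ℝ) := by
    rw [sub_pos, div_lt_one (by linarith)]; exact hk1
  rw [← Real.log_le_log_iff (by positivity) (by positivity), Real.log_pow, one_div, Real.log_inv]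
  have h1 := Real.one_sub_inv_le_log_of_pos hp
  have h2 : 1 - (1 - 1 / (k : ℝ))⁻¹ = -(1 / ((k : ℝ) - 1)) := by
    have : (k : ℝ) - 1 ≠ 0 := by linarith
    field_simp
    ring
  rw [h2] at h1
  have h3 : (t : ℝ) * (1 / ((k : ℝ) - 1)) ≤ Real.log x := by
    rw [mul_one_div, div_le_iff₀ (by linarith)]
    linarith
  nlinarith [mul_le_mul_of_nonneg_left h1 (Nat.cast_nonneg (α := ℝ) t)]

/-- With `r + 1` missing coupons, `20 * (r + 1) ≤ k`, more than `(k - 1) * log (r + 2)` samples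
are needed. -/
theorem CouponLearner.Solves.log_lt {n k s t : ℕ} {δ : ℝ} {A : CouponLearner n t}
    (hA : A.Solves k δ) (hδ : δ ≤ 1 / 40) (hs : 20 * (s + 1) ≤ k) (hn : k + s + 1 ≤ n) :
    ((k : ℝ) - 1) * Real.log ((s : ℝ) + 2) < t := by
  by_contra! ht
  have h1 := hA.one_sub_le (s := s) (by omega) hn
  have hk1 : (1 : ℝ) < k := by
    have : 1 < k := by omega
    exact_mod_cast this
  have hq := inv_le_one_sub_inv_pow (by omega) (by positivity) ht
  have hq1 : (1 - 1 / (k : ℝ)) ^ t ≤ 1 := by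
    have : 0 < 1 / (k : ℝ) := by positivity
    refine pow_le_one₀ ?_ (by linarith)
    rw [sub_nonneg, div_le_one (by linarith)]; exact hk1.le
  have h2 := one_sub_pow_le_half (r := s + 1) (by omega) (q := (1 - 1 / (k : ℝ)) ^ t)
    (by push_cast; rwa [show (s : ℝ) + 1 + 1 = s + 2 by ring]) hq1
  have hs' : 20 * ((s : ℝ) + 1) ≤ k := by exact_mod_cast hs
  have h3 : ((s : ℝ) + 1) / ((k : ℝ) + 1 - s) ≤ 1 / 19 := by
    rw [div_le_div_iff₀ (by linarith [Nat.cast_nonneg (α := ℝ) s]) (by norm_num)]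
    linarith
  -- `5/4 · 1/2 + 5 · 1/19 < 39/40 ≤ 1 - δ`.
  linarith

/-- The factor `1 - 1/k` pays for `k - 1` in place of `k`, the other for the cap `s + 1 ≤ k/20`. -/
theorem tendsto_couponEps :
    Tendsto (fun k : ℕ => 1 - (1 - 1 / (k : ℝ)) * (1 - Real.log 20 / Real.log k)) atTop (𝓝 0) := by
  have h1 : Tendsto (fun k : ℕ => 1 / (k : ℝ)) atTop (𝓝 0) := tendsto_one_div_atTop_nhds_zero_nat
  have h2 : Tendsto (fun k : ℕ => Real.log 20 / Real.log k) atTop (𝓝 0) :=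
    (Real.tendsto_log_atTop.comp tendsto_natCast_atTop_atTop).const_div_atTop _
  have h3 := ((h1.const_sub 1).mul (h2.const_sub 1)).const_sub 1
  simpa using h3

theorem mainTheorem4 (δ : ℝ) (hδ : δ ∈ Set.Ioc (0 : ℝ) (1 / 40)) :
    ∃ ε : ℕ → ℝ, Tendsto ε atTop (𝓝 0) ∧
      ∀ k n : ℕ, 1 < k → k < n →
        Real.log (k : ℝ) / (k : ℝ) ≤ min (couponConst δ / 20) (δ * Real.log 2) →
        ∀ (t : ℕ) (A : CouponLearner n t), A.Solves k δ →
          (1 - ε k) * ((k : ℝ) * Real.log (min (k : ℝ) (((n : ℝ) - (k : ℝ)) + 1))) ≤ (t : ℝ) := by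
  refine ⟨_, tendsto_couponEps, ?_⟩
  intro k n hk hkn _ t A hA
  have hk1 : (1 : ℝ) < k := by exact_mod_cast hk
  have hkn1 : (k : ℝ) + 1 ≤ n := by exact_mod_cast hkn
  have hlogk : 0 < Real.log k := Real.log_pos hk1
  set M : ℝ := min (k : ℝ) (((n : ℝ) - (k : ℝ)) + 1) with hM
  have hM1 : 1 < M := lt_min hk1 (by linarith)
  have hlogM : 0 < Real.log M := Real.log_pos hM1
  have hlogMk : Real.log M ≤ Real.log k := Real.log_le_log (by linarith) (min_le_left _ _)
  have hrw : (1 - (1 - (1 - 1 / (k : ℝ)) * (1 - Real.log 20 / Real.log k))) *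
      ((k : ℝ) * Real.log M) =
      ((k : ℝ) - 1) * ((1 - Real.log 20 / Real.log k) * Real.log M) := by
    have : (k : ℝ) ≠ 0 := by linarith
    field_simp
    ring
  rw [hrw]
  have hlog20 : 0 < Real.log 20 := Real.log_pos (by norm_num)
  -- Below 20 no `s` is available, but the claimed bound is not positive.
  rcases lt_or_ge k 20 with hk20 | hk20
  · have h1 : Real.log k < Real.log 20 :=
      Real.log_lt_log (by linarith) (by exact_mod_cast hk20)
    have h2 : 1 - Real.log 20 / Real.log k ≤ 0 := by
      rw [sub_nonpos, le_div_iff₀ hlogk]; linarith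
    have h3 : ((k : ℝ) - 1) * ((1 - Real.log 20 / Real.log k) * Real.log M) ≤ 0 :=
      mul_nonpos_of_nonneg_of_nonpos (by linarith)
        (mul_nonpos_of_nonpos_of_nonneg h2 hlogM.le)
    exact h3.trans (Nat.cast_nonneg t)
  have hle : (1 - Real.log 20 / Real.log k) * Real.log M ≤ Real.log k - Real.log 20 := by
    have h1 : 0 ≤ 1 - Real.log 20 / Real.log k := by
      rw [sub_nonneg, div_le_one hlogk]
      exact Real.log_le_log (by norm_num) (by exact_mod_cast hk20)
    calc _ ≤ (1 - Real.log 20 / Real.log k) * Real.log k := by gcongr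
      _ = _ := by field_simp
  have hmain : ∃ s : ℕ, 20 * (s + 1) ≤ k ∧ k + s + 1 ≤ n ∧
      (1 - Real.log 20 / Real.log k) * Real.log M ≤ Real.log ((s : ℝ) + 2) := by
    rcases le_total (n - k) (k / 20) with h | h
    · refine ⟨n - k - 1, by omega, by omega, ?_⟩
      have h1 : ((n - k - 1 : ℕ) : ℝ) + 2 = (n : ℝ) - k + 1 := by
        have : n = k + (n - k - 1) + 1 := by omega
        have h2 : (n : ℝ) = k + ((n - k - 1 : ℕ) : ℝ) + 1 := by exact_mod_cast this
        linarith
      rw [h1]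
      calc _ ≤ 1 * Real.log M := by
            gcongr
            have : 0 < Real.log 20 / Real.log k := by positivity
            linarith
        _ ≤ _ := by
            rw [one_mul]
            exact Real.log_le_log (by linarith) (min_le_right _ _)
    · refine ⟨k / 20 - 1, by omega, by omega, hle.trans ?_⟩
      rw [← Real.log_div (by linarith) (by norm_num)]
      refine Real.log_le_log (by positivity) ?_
      rw [div_le_iff₀ (by norm_num)]
      have : k ≤ (k / 20 - 1 + 2) * 20 := by omega
      exact_mod_cast this
  obtain ⟨s, hs, hn, hlog⟩ := hmain
  refine le_trans ?_ (hA.log_lt hδ.2 hs hn).le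
  exact mul_le_mul_of_nonneg_left hlog (by linarith)
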